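/- Let $\mathbb{I}^3=\mathbb{R}^3$ with coordinates $(t,x,y)$ and the degenerate inner product $dx^2+dy^2$. A map $f\colon\mathbb{C}\to\mathbb{I}^3$ is a ZMC-face if $f=\operatorname{Re}F$ for some holomorphic immersion $F=(F^0,F^1,F^2)\colon\mathbb{C}\to\mathbb{C}^3$ (a holomorphic lift of $f$) with $(dF^1)^2+(dF^2)^2=0$ and $F^1$ non-constant. It is of finite type if its lift-metric $ds^2_\#=|dF^0|^2+|dF^1|^2+|dF^2|^2$ is a Riemannian metric with finite absolute total Gaussian curvature, i.e. $\int_{\mathbb{C}}|K_\#|\,dA_\#<\infty$. Let $\varphi\colon\mathbb{R}^2\to\mathbb{R}$ be a harmonic function, identify $\mathbb{R}^2$ with $\mathbb{C}$ by $z=x+iy$, put $\varphi_z=\tfrac12(\varphi_x-i\varphi_y)$, and let $f\colon\mathbb{C}\to\mathbb{I}^3$, $f(x+iy)=(\varphi(x,y),x,y)$, be the graph of $\varphi$. Then $f$ is a ZMC-face, and $f$ is of finite type if and only if $\varphi$ is a harmonic polynomial. Moreover, the lift-metric of $f$ (for every holomorphic lift) is $(2+|2\varphi_z|^2)\,|dz|^2$;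 $f$ is of finite type if and only if this metric has finite absolute total curvature, and this holds if and only if $\varphi_z$ is a polynomial in $z$ with complex coefficients. -/

import Mathlib

open MeasureTheory

noncomputable section

namespace IsotropicSpace

/-- The underlying vector space of the isotropic `3`-space, with coordinates `(t, x, y)` indexed by
`0, 1, 2`; its degenerate inner product is `dx² + dy²`. -/
abbrev I3 : Type := Fin 3 → ℝ

/-- A `(0++)`-type null holomorphic immersion `F = (F⁰, F¹, F²) : ℂ → ℂ³`. -/
structure IsNullImmersion (F : ℂ → Fin 3 → ℂ) : Prop where
  holomorphic : Differentiable ℂ F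
  immersion : ∀ z, deriv F z ≠ 0
  null : ∀ z, deriv (fun w => F w 1) z ^ 2 + deriv (fun w => F w 2) z ^ 2 = 0
  nonconstant : ¬ ∃ c : ℂ, ∀ z, F z 1 = c

/-- `F` is a holomorphic lift of `f : ℂ → 𝕀³`. The universal cover of `ℂ` is `ℂ` itself. -/
structure IsHolomorphicLift (F : ℂ → Fin 3 → ℂ) (f : ℂ → I3) : Prop where
  isNullImmersion : IsNullImmersion F
  re_eq : ∀ z i, f z i = (F z i).re

/-- ZMC-faces defined on the Riemann surface `ℂ`. -/
def IsZMCFace (f : ℂ → I3) : Prop :=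
  ∃ F : ℂ → Fin 3 → ℂ, IsHolomorphicLift F f

/-- The density `ρ` of the lift-metric `|dF⁰|² + |dF¹|² + |dF²|² = ρ |dz|²`. -/
def liftDensity (F : ℂ → Fin 3 → ℂ) (z : ℂ) : ℝ :=
  ∑ i, ‖deriv (fun w => F w i) z‖ ^ 2

/-- `ρ |dz|²` is a (smooth, conformal) Riemannian metric on `ℂ`. -/
def IsConformalMetric (ρ : ℂ → ℝ) : Prop :=
  ContDiff ℝ (⊤ : ℕ∞) ρ ∧ ∀ z, 0 < ρ z

/-- The Gaussian curvature `K = - Δ(log ρ) / (2ρ)` of the metric `ρ |dz|²`. -/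
def gaussCurvature (ρ : ℂ → ℝ) (z : ℂ) : ℝ :=
  -(Laplacian.laplacian (fun w => Real.log (ρ w)) z) / (2 * ρ z)

/-- The area measure `dA = ρ dx dy` of the metric `ρ |dz|²`. -/
def areaMeasure (ρ : ℂ → ℝ) : Measure ℂ :=
  volume.withDensity fun z => ENNReal.ofReal (ρ z)

/-- The metric `ρ |dz|²` has finite absolute total curvature: `∫ |K| dA < ∞`. -/
def HasFiniteTotalCurvature (ρ : ℂ → ℝ) : Prop :=
  ∫⁻ z, ‖gaussCurvature ρ z‖ₑ ∂(areaMeasure ρ) < ⊤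

/-- `f` is a finite-type ZMC-face: its lift-metric is a Riemannian metric with finite absolute
total curvature. (Two lifts of `f` differ by a constant, so they have the same lift-metric.) -/
def IsFiniteTypeZMCFace (f : ℂ → I3) : Prop :=
  ∃ F : ℂ → Fin 3 → ℂ, IsHolomorphicLift F f ∧
    IsConformalMetric (liftDensity F) ∧ HasFiniteTotalCurvature (liftDensity F)

/-- The graph `x + iy ↦ (φ(x, y), x, y)`, where `ℝ²` is identified with `ℂ`. -/
def graph (φ : ℂ → ℝ) (z : ℂ) : I3 := ![φ z, z.re, z.im]

/-- The Wirtinger derivative `φ_z = (φ_x - i φ_y) / 2`. -/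
def wirtinger (φ : ℂ → ℝ) (z : ℂ) : ℂ :=
  ((fderiv ℝ φ z 1 : ℂ) - Complex.I * (fderiv ℝ φ z Complex.I : ℂ)) / 2

/-- `φ` is a harmonic function that is a real polynomial in `x` and `y`. -/
def IsHarmonicPolynomial (φ : ℂ → ℝ) : Prop :=
  InnerProductSpace.HarmonicOnNhd φ Set.univ ∧
    ∃ P : MvPolynomial (Fin 2) ℝ, ∀ z : ℂ, φ z = MvPolynomial.eval ![z.re, z.im] P

end IsotropicSpace

end

/-! A harmonic `φ` on the plane is `Re G` with `G` entire, and `(G, z, -iz)` lifts the graph. The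
derivative of a lift is determined by its real part, so every lift has density `2 + |g|²` with `g =
G' = 2φ_z`. Since `K = -Δ log ρ / (2ρ)`, the total curvature is half the mass of `Δ log (2 + |g|²) =
8|g'|² / (2 + |g|²)²`, a multiple of the spherical area covered by `g`. The core is that an entire
`g` covers finite area exactly when it is a polynomial (`hasFiniteTotalCurvature_iff_polynomial`).

If the mass is finite, Green's formula bounds the flux of `log (2 + |g|²)` through circles about 0,
so its circle averages grow at most like `log r`. Jensen's formula and a comparison of discs turn
this into a pointwise bound `log |g(c)| = O(log |c|)`, and Cauchy's estimates finish. Conversely,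
for a nonconstant polynomial the density is `O(|z|⁻⁴)` at infinity.

Finally `φ` is a polynomial in `x, y` iff `G'` is one in `z`: `G' = φ_x - iφ_y` is a polynomial on
the real axis, hence everywhere; the converse integrates `G'`. -/

noncomputable section

namespace IsotropicSpace

/-! ### The Laplacian of `log (2 + ‖g‖²)`. -/

/-- First derivative of `log (2 + ‖h‖²)` along a curve with `h = a`, `h' = b`. -/
def logDeriv₁ (a b : ℂ) : ℝ := 2 * inner ℝ a b / (2 + ‖a‖ ^ 2)

/-- Second derivative of `log (2 + ‖h‖²)` along a curve with `h = a`, `h' = b`, `h'' = c`. -/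
def logDeriv₂ (a b c : ℂ) : ℝ :=
  2 * (inner ℝ a c + ‖b‖ ^ 2) / (2 + ‖a‖ ^ 2) - (2 * inner ℝ a b) ^ 2 / (2 + ‖a‖ ^ 2) ^ 2

/-- The density of `Δ log (2 + ‖g‖²)`. -/
def logLaplacian (g : ℂ → ℂ) (z : ℂ) : ℝ := 8 * ‖deriv g z‖ ^ 2 / (2 + ‖g z‖ ^ 2) ^ 2

lemma two_add_norm_sq_pos (a : ℂ) : 0 < 2 + ‖a‖ ^ 2 := by positivity

lemma hasDerivAt_log_two_add_norm_sq {h : ℝ → ℂ} {h' : ℂ} {t : ℝ} (hh : HasDerivAt h h' t) :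
    HasDerivAt (fun t => Real.log (2 + ‖h t‖ ^ 2)) (logDeriv₁ (h t) h') t :=
  ((hh.norm_sq).const_add 2).log (two_add_norm_sq_pos _).ne'

lemma hasDerivAt_logDeriv₁ {h k : ℝ → ℂ} {h'' : ℂ} {t : ℝ} (hh : HasDerivAt h (k t) t)
    (hk : HasDerivAt k h'' t) :
    HasDerivAt (fun t => logDeriv₁ (h t) (k t)) (logDeriv₂ (h t) (k t) h'') t := by
  have h1 := ((hh.inner ℝ hk).const_mul 2).div ((hh.norm_sq).const_add 2)
    (two_add_norm_sq_pos (h t)).ne'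
  refine h1.congr_deriv ?_
  have := (two_add_norm_sq_pos (h t)).ne'
  rw [logDeriv₂, real_inner_self_eq_norm_sq]
  field_simp

/-- For holomorphic `h`, the directions 1 and `i` have second derivatives `c` and `-c`, which cancel
in the sum. The squared first-order terms combine by Pythagoras, as `b` and `bi` are orthogonal of
equal length. -/
lemma logDeriv₂_add_rotate (a b c : ℂ) :
    logDeriv₂ a b c + logDeriv₂ a (b * Complex.I) (-c) = 8 * ‖b‖ ^ 2 / (2 + ‖a‖ ^ 2) ^ 2 := by
  have h := (two_add_norm_sq_pos a).ne'
  simp only [logDeriv₂, inner_neg_right, norm_mul, Complex.norm_I, mul_one]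
  have hi : inner ℝ a b ^ 2 + inner ℝ a (b * Complex.I) ^ 2 = ‖a‖ ^ 2 * ‖b‖ ^ 2 := by
    simp only [Complex.inner, ← Complex.normSq_eq_norm_sq, Complex.normSq_apply]
    simp
    ring
  field_simp
  linear_combination (-4) * hi

lemma continuous_logDeriv₁ {X : Type*} [TopologicalSpace X] {a b : X → ℂ} (ha : Continuous a)
    (hb : Continuous b) : Continuous fun x => logDeriv₁ (a x) (b x) := by
  unfold logDeriv₁
  exact (continuous_const.mul (ha.inner hb)).div (by fun_prop)
    fun x => (two_add_norm_sq_pos _).ne'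

lemma continuous_logDeriv₂ {X : Type*} [TopologicalSpace X] {a b c : X → ℂ} (ha : Continuous a)
    (hb : Continuous b) (hc : Continuous c) : Continuous fun x => logDeriv₂ (a x) (b x) (c x) := by
  unfold logDeriv₂
  refine Continuous.sub ?_ ?_
  · exact (continuous_const.mul ((ha.inner hc).add (by fun_prop))).div (by fun_prop)
      fun x => (two_add_norm_sq_pos _).ne'
  · exact ((continuous_const.mul (ha.inner hb)).pow 2).div (by fun_prop)
      fun x => pow_ne_zero 2 (two_add_norm_sq_pos _).ne'

lemma continuous_log_two_add_norm_sq {X : Type*} [TopologicalSpace X] {a : X → ℂ}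
    (ha : Continuous a) : Continuous fun x => Real.log (2 + ‖a x‖ ^ 2) :=
  Continuous.log (by fun_prop) fun _ => (two_add_norm_sq_pos _).ne'

lemma differentiable_deriv {g : ℂ → ℂ} (hg : Differentiable ℂ g) : Differentiable ℂ (deriv g) :=
  (hg.contDiff (n := 2)).differentiable_deriv_two

lemma logLaplacian_nonneg (g : ℂ → ℂ) (z : ℂ) : 0 ≤ logLaplacian g z := by
  unfold logLaplacian; positivity

lemma continuous_logLaplacian {g : ℂ → ℂ} (hg : Differentiable ℂ g) :
    Continuous (logLaplacian g) := by
  have h1 := hg.continuous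
  have h2 := (differentiable_deriv hg).continuous
  exact (by fun_prop : Continuous fun z => 8 * ‖deriv g z‖ ^ 2).div (by fun_prop)
    fun x => pow_ne_zero 2 (two_add_norm_sq_pos _).ne'

lemma hasDerivAt_comp_line {g : ℂ → ℂ} (hg : Differentiable ℂ g) (z e : ℂ) (t : ℝ) :
    HasDerivAt (fun s : ℝ => g (z + s * e)) (deriv g (z + t * e) * e) t := by
  have h1 : HasDerivAt (fun s : ℝ => z + (s : ℂ) * e) e t := by
    simpa using ((Complex.ofRealCLM.hasDerivAt (x := t)).mul_const e).const_add z
  exact (hg _).hasDerivAt.comp t h1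

lemma contDiff_two_add_norm_sq {g : ℂ → ℂ} (hg : Differentiable ℂ g) {n : ℕ∞} :
    ContDiff ℝ n (fun z => 2 + ‖g z‖ ^ 2) :=
  contDiff_const.add ((hg.contDiff.restrict_scalars ℝ).norm_sq ℝ)

/-- Reduces the Laplacian to one-variable calculus along lines. -/
lemma iteratedFDeriv_two_eq_of_hasDerivAt {u : ℂ → ℝ} (hu : ContDiff ℝ 2 u) (z e : ℂ)
    {u' : ℝ → ℝ} {u'' : ℝ} (h1 : ∀ t : ℝ, HasDerivAt (fun s : ℝ => u (z + s * e)) (u' t) t)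
    (h2 : HasDerivAt u' u'' 0) : iteratedFDeriv ℝ 2 u z ![e, e] = u'' := by
  have hl : ∀ t : ℝ, HasDerivAt (fun s : ℝ => z + (s : ℂ) * e) e t := fun t => by
    simpa using ((Complex.ofRealCLM.hasDerivAt (x := t)).mul_const e).const_add z
  have hd : Differentiable ℝ u := hu.differentiable (by norm_num)
  have e1 : u' = fun t : ℝ => fderiv ℝ u (z + t * e) e := by
    funext t
    exact (h1 t).unique ((hd _).hasFDerivAt.comp_hasDerivAt t (hl t))
  have hd2 : Differentiable ℝ (fderiv ℝ u) :=
    (hu.fderiv_right (m := 1) (by norm_num)).differentiable (by norm_num)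
  have h3 : HasDerivAt (fun t : ℝ => fderiv ℝ u (z + t * e))
      (fderiv ℝ (fderiv ℝ u) (z + (0 : ℝ) * e) e) 0 :=
    (hd2 _).hasFDerivAt.comp_hasDerivAt 0 (hl 0)
  have h4 := h3.clm_apply (hasDerivAt_const (0 : ℝ) e)
  rw [e1] at h2
  have := h2.unique h4
  rw [this, iteratedFDeriv_two_apply]
  simp

lemma laplacian_log_two_add_norm_sq {g : ℂ → ℂ} (hg : Differentiable ℂ g) (z : ℂ) :
    Laplacian.laplacian (fun w => Real.log (2 + ‖g w‖ ^ 2)) z = logLaplacian g z := by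
  have hu : ContDiff ℝ 2 (fun w => Real.log (2 + ‖g w‖ ^ 2)) :=
    (contDiff_two_add_norm_sq hg (n := 2)).log fun x => (two_add_norm_sq_pos _).ne'
  have key : ∀ e : ℂ, iteratedFDeriv ℝ 2 (fun w => Real.log (2 + ‖g w‖ ^ 2)) z ![e, e] =
      logDeriv₂ (g z) (deriv g z * e) (deriv (deriv g) z * e * e) := by
    intro e
    refine iteratedFDeriv_two_eq_of_hasDerivAt hu z e
      (u' := fun t => logDeriv₁ (g (z + t * e)) (deriv g (z + t * e) * e))
      (fun t => hasDerivAt_log_two_add_norm_sq (hasDerivAt_comp_line hg z e t)) ?_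
    have := hasDerivAt_logDeriv₁ (h := fun t : ℝ => g (z + t * e)) (t := 0)
      (k := fun t => deriv g (z + t * e) * e) (hasDerivAt_comp_line hg z e 0)
      ((hasDerivAt_comp_line (differentiable_deriv hg) z e 0).mul_const e)
    simpa using this
  rw [InnerProductSpace.laplacian_eq_iteratedFDeriv_complexPlane]
  simp only [key]
  have := logDeriv₂_add_rotate (g z) (deriv g z) (deriv (deriv g) z)
  rw [logLaplacian, ← this]
  simp [mul_assoc]

/-! ### Total curvature as a mass. -/

/-- The total curvature of `(2 + ‖g‖²) |dz|²` is half of the total mass of `Δ log (2 + ‖g‖²)`. -/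
lemma hasFiniteTotalCurvature_iff_integrable {g : ℂ → ℂ} (hg : Differentiable ℂ g) :
    HasFiniteTotalCurvature (fun z => 2 + ‖g z‖ ^ 2) ↔ Integrable (logLaplacian g) := by
  have hc := hg.continuous
  have hL := continuous_logLaplacian hg
  have hK : gaussCurvature (fun z => 2 + ‖g z‖ ^ 2) =
      fun z => -logLaplacian g z / (2 * (2 + ‖g z‖ ^ 2)) := by
    funext z
    rw [gaussCurvature, laplacian_log_two_add_norm_sq hg]
  have hKc : Continuous fun z => -logLaplacian g z / (2 * (2 + ‖g z‖ ^ 2)) :=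
    hL.neg.div (by fun_prop) fun z => (mul_pos two_pos (two_add_norm_sq_pos _)).ne'
  rw [HasFiniteTotalCurvature, areaMeasure, hK,
    lintegral_withDensity_eq_lintegral_mul _ (by fun_prop) hKc.enorm.measurable]
  have e : ∀ z, ((fun z => ENNReal.ofReal (2 + ‖g z‖ ^ 2)) *
      fun z => ‖-logLaplacian g z / (2 * (2 + ‖g z‖ ^ 2))‖ₑ) z =
      ‖(2⁻¹ : ℝ) * logLaplacian g z‖ₑ := by
    intro z
    have hp := two_add_norm_sq_pos (g z)
    have h0 := logLaplacian_nonneg g z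
    rw [Pi.mul_apply, Real.enorm_eq_ofReal_abs, Real.enorm_eq_ofReal_abs,
      ← ENNReal.ofReal_mul hp.le, abs_div, abs_neg, abs_of_nonneg h0, abs_of_pos (by positivity),
      abs_of_nonneg (by positivity)]
    congr 1
    field_simp
  rw [lintegral_congr e, ← integrable_const_mul_iff (c := (2⁻¹ : ℝ)) (by norm_num) ]
  exact ⟨fun h => ⟨(hL.const_smul (2⁻¹ : ℝ)).aestronglyMeasurable, h⟩, fun h => h.2⟩

/-! ### Green's formula on a period strip. -/

lemma intervalIntegral_swap_of_continuous {f : ℝ → ℝ → ℝ} (hf : Continuous (Function.uncurry f))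
    (a b c d : ℝ) :
    ∫ x in a..b, ∫ y in c..d, f x y = ∫ y in c..d, ∫ x in a..b, f x y := by
  apply intervalIntegral_intervalIntegral_swap
  have : IntegrableOn (Function.uncurry f) (Set.uIcc a b ×ˢ Set.uIcc c d) :=
    hf.continuousOn.integrableOn_compact (isCompact_uIcc.prod isCompact_uIcc)
  exact this.mono_set (Set.prod_mono Set.uIoc_subset_uIcc Set.uIoc_subset_uIcc)

section Strip

variable {H : ℂ → ℂ}

lemma hasDerivAt_horizontal (hH : Differentiable ℂ H) (s θ : ℝ) :
    HasDerivAt (fun t : ℝ => H (t + θ * Complex.I)) (deriv H (s + θ * Complex.I)) s := by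
  simpa [add_comm] using hasDerivAt_comp_line hH (θ * Complex.I) 1 s

lemma hasDerivAt_vertical (hH : Differentiable ℂ H) (s θ : ℝ) :
    HasDerivAt (fun t : ℝ => H (s + t * Complex.I)) (deriv H (s + θ * Complex.I) * Complex.I) θ :=
  hasDerivAt_comp_line hH s Complex.I θ

/-- The flux `∫ ∂ₛ log (2 + ‖H‖²) dθ` through a vertical segment. -/
def verticalFlux (H : ℂ → ℂ) (s : ℝ) : ℝ :=
  ∫ θ in (0 : ℝ)..(2 * Real.pi), logDeriv₁ (H (s + θ * Complex.I)) (deriv H (s + θ * Complex.I))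

lemma continuous_strip : Continuous fun p : ℝ × ℝ => (p.1 : ℂ) + p.2 * Complex.I := by fun_prop

lemma continuous_strip_logDeriv₁ (hH : Differentiable ℂ H) :
    Continuous (Function.uncurry fun s θ : ℝ =>
      logDeriv₁ (H (s + θ * Complex.I)) (deriv H (s + θ * Complex.I))) :=
  continuous_logDeriv₁ (hH.continuous.comp continuous_strip)
    ((differentiable_deriv hH).continuous.comp continuous_strip)

lemma continuous_verticalFlux (hH : Differentiable ℂ H) : Continuous (verticalFlux H) :=
  intervalIntegral.continuous_parametric_intervalIntegral_of_continuous'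
    (continuous_strip_logDeriv₁ hH) _ _

lemma integral_log_sub_eq_integral_verticalFlux (hH : Differentiable ℂ H) (a b : ℝ) :
    (∫ θ in (0 : ℝ)..(2 * Real.pi), Real.log (2 + ‖H (b + θ * Complex.I)‖ ^ 2)) -
      (∫ θ in (0 : ℝ)..(2 * Real.pi), Real.log (2 + ‖H (a + θ * Complex.I)‖ ^ 2)) =
      ∫ s in a..b, verticalFlux H s := by
  have hc : ∀ s : ℝ, Continuous fun θ : ℝ => Real.log (2 + ‖H (s + θ * Complex.I)‖ ^ 2) :=
    fun s => continuous_log_two_add_norm_sq (hH.continuous.comp (by fun_prop))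
  unfold verticalFlux
  rw [intervalIntegral_swap_of_continuous (continuous_strip_logDeriv₁ hH),
    ← intervalIntegral.integral_sub ((hc b).intervalIntegrable _ _)
      ((hc a).intervalIntegrable _ _)]
  refine intervalIntegral.integral_congr fun θ _ => ?_
  refine (intervalIntegral.integral_eq_sub_of_hasDerivAt
    (fun s _ => hasDerivAt_log_two_add_norm_sq (hasDerivAt_horizontal hH s θ)) ?_).symm
  exact ((continuous_strip_logDeriv₁ hH).comp (by fun_prop :
    Continuous fun s : ℝ => (s, θ))).intervalIntegrable _ _

/-- Green's formula on a period rectangle of a `2πi`-periodic entire function. -/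
lemma verticalFlux_sub_eq_integral_logLaplacian (hH : Differentiable ℂ H)
    (hper : ∀ w, H (w + 2 * Real.pi * Complex.I) = H w) (a b : ℝ) :
    verticalFlux H b - verticalFlux H a =
      ∫ s in a..b, ∫ θ in (0 : ℝ)..(2 * Real.pi), logLaplacian H (s + θ * Complex.I) := by
  have hH' := differentiable_deriv hH
  have c0 := hH.continuous.comp continuous_strip
  have c1 := hH'.continuous.comp continuous_strip
  have c2 := (differentiable_deriv hH').continuous.comp continuous_strip
  have hper' : ∀ w, deriv H (w + 2 * Real.pi * Complex.I) = deriv H w := by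
    intro w
    rw [← deriv_comp_add_const]
    congr 1
    funext x
    exact hper x
  -- `D` is the second derivative in the `θ` direction; its integral over a period vanishes.
  set D : ℝ → ℝ → ℝ := fun s θ => logDeriv₂ (H (s + θ * Complex.I))
    (deriv H (s + θ * Complex.I) * Complex.I) (-deriv (deriv H) (s + θ * Complex.I)) with hD
  have cD : Continuous (Function.uncurry D) :=
    continuous_logDeriv₂ c0 (c1.mul continuous_const) c2.neg
  have cE : Continuous fun p : ℝ × ℝ => logDeriv₂ (H (p.1 + p.2 * Complex.I))
      (deriv H (p.1 + p.2 * Complex.I)) (deriv (deriv H) (p.1 + p.2 * Complex.I)) :=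
    continuous_logDeriv₂ c0 c1 c2
  have cL : Continuous (Function.uncurry fun s θ : ℝ => logLaplacian H (s + θ * Complex.I)) :=
    (continuous_logLaplacian hH).comp continuous_strip
  have hD0 : ∫ s in a..b, ∫ θ in (0 : ℝ)..(2 * Real.pi), D s θ = 0 := by
    refine (intervalIntegral.integral_congr (g := fun _ => (0 : ℝ)) fun s _ => ?_).trans (by simp)
    have hd : ∀ θ : ℝ, HasDerivAt (fun t : ℝ => logDeriv₁ (H (s + t * Complex.I))
        (deriv H (s + t * Complex.I) * Complex.I)) (D s θ) θ := by
      intro θ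
      have := hasDerivAt_logDeriv₁ (h := fun t : ℝ => H (s + t * Complex.I))
        (k := fun t : ℝ => deriv H (s + t * Complex.I) * Complex.I)
        (hasDerivAt_vertical hH s θ) ((hasDerivAt_vertical hH' s θ).mul_const Complex.I)
      simpa [hD, mul_assoc] using this
    simp only
    rw [intervalIntegral.integral_eq_sub_of_hasDerivAt (fun θ _ => hd θ)
      ((cD.comp (by fun_prop : Continuous fun θ : ℝ => (s, θ))).intervalIntegrable _ _)]
    have e1 := hper s
    have e2 := hper' s
    simp [e1, e2]
  have hi : ∀ s : ℝ, IntervalIntegrable (fun θ : ℝ => logDeriv₁ (H (s + θ * Complex.I))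
      (deriv H (s + θ * Complex.I))) volume 0 (2 * Real.pi) := fun s =>
    ((continuous_strip_logDeriv₁ hH).comp (by fun_prop :
      Continuous fun θ : ℝ => (s, θ))).intervalIntegrable _ _
  -- The horizontal second derivative is the Laplacian minus `D`, and it integrates in `s` to the
  -- difference of first derivatives.
  have hstep : ∀ θ : ℝ, logDeriv₁ (H (b + θ * Complex.I)) (deriv H (b + θ * Complex.I)) -
      logDeriv₁ (H (a + θ * Complex.I)) (deriv H (a + θ * Complex.I)) =
      (∫ s in a..b, logLaplacian H (s + θ * Complex.I)) - ∫ s in a..b, D s θ := by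
    intro θ
    have iL : IntervalIntegrable (fun s : ℝ => logLaplacian H (s + θ * Complex.I)) volume a b :=
      (cL.comp (by fun_prop : Continuous fun s : ℝ => (s, θ))).intervalIntegrable _ _
    have iD : IntervalIntegrable (fun s : ℝ => D s θ) volume a b :=
      (cD.comp (by fun_prop : Continuous fun s : ℝ => (s, θ))).intervalIntegrable _ _
    rw [← intervalIntegral.integral_sub iL iD,
      ← intervalIntegral.integral_eq_sub_of_hasDerivAt
      (fun s _ => hasDerivAt_logDeriv₁ (k := fun t : ℝ => deriv H (t + θ * Complex.I))
        (hasDerivAt_horizontal hH s θ) (hasDerivAt_horizontal hH' s θ))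
      ((cE.comp (by fun_prop : Continuous fun s : ℝ => (s, θ))).intervalIntegrable _ _)]
    refine intervalIntegral.integral_congr fun s _ => ?_
    simp only [hD, logLaplacian, ← logDeriv₂_add_rotate _ _ (deriv (deriv H) (s + θ * Complex.I))]
    ring
  unfold verticalFlux
  rw [← intervalIntegral.integral_sub (hi b) (hi a)]
  simp only [hstep]
  have cont_int : ∀ {f : ℝ → ℝ → ℝ}, Continuous (Function.uncurry f) →
      Continuous fun θ => ∫ s in a..b, f s θ := fun {f} hf =>
    intervalIntegral.continuous_parametric_intervalIntegral_of_continuous'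
      (f := fun θ s => f s θ) (hf.comp continuous_swap) _ _
  rw [intervalIntegral.integral_sub ((cont_int cL).intervalIntegrable _ _)
    ((cont_int cD).intervalIntegrable _ _), ← intervalIntegral_swap_of_continuous cL,
    ← intervalIntegral_swap_of_continuous cD, hD0, sub_zero]

end Strip

/-! ### Circle averages and polar coordinates. -/

lemma continuous_circleAverage {v : ℂ → ℝ} (hv : Continuous v) (c : ℂ) :
    Continuous fun r => Real.circleAverage v c r := by
  unfold Real.circleAverage
  have h : Continuous (Function.uncurry fun r θ : ℝ => v (circleMap c r θ)) := by
    unfold circleMap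
    exact hv.comp (by fun_prop)
  exact (intervalIntegral.continuous_parametric_intervalIntegral_of_continuous' (μ := volume)
    h 0 (2 * Real.pi)).const_smul (2 * Real.pi)⁻¹

/-- Integration over a disc in polar coordinates. -/
lemma setIntegral_ball_eq_integral_circleAverage {v : ℂ → ℝ} (hv : Continuous v) (c : ℂ) {R : ℝ}
    (hR : 0 ≤ R) :
    ∫ z in Metric.ball c R, v z =
      2 * Real.pi * ∫ r in (0 : ℝ)..R, r * Real.circleAverage v c r := by
  have h1 : ∫ z in Metric.ball c R, v z =
      ∫ z, (Metric.ball (0 : ℂ) R).indicator (fun w => v (c + w)) z := by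
    rw [← integral_indicator Metric.isOpen_ball.measurableSet, ← integral_add_left_eq_self _ c]
    congr 1
    funext z
    simp [Set.indicator]
  have h2 : ∀ p ∈ polarCoord.target,
      p.1 • (Metric.ball (0 : ℂ) R).indicator (fun w => v (c + w)) (Complex.polarCoord.symm p) =
      (Set.Ioo (0 : ℝ) R ×ˢ Set.Ioo (-Real.pi) Real.pi).indicator
        (fun p => p.1 * v (circleMap c p.1 p.2)) p := by
    rintro ⟨r, θ⟩ hp
    obtain ⟨hr, hθ⟩ := hp
    simp only [Set.mem_Ioi] at hr
    have e : c + Complex.polarCoord.symm (r, θ) = circleMap c r θ := by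
      rw [Complex.polarCoord_symm_apply, circleMap, Complex.exp_mul_I]
      simp
    by_cases hrR : r < R
    · rw [Set.indicator_of_mem, Set.indicator_of_mem, e, smul_eq_mul]
      · exact ⟨⟨hr, hrR⟩, hθ⟩
      · simpa [abs_of_pos hr] using hrR
    · rw [Set.indicator_of_notMem, Set.indicator_of_notMem, smul_zero]
      · exact fun h => hrR h.1.2
      · simpa [abs_of_pos hr] using hrR
  have hcm : Continuous fun p : ℝ × ℝ => p.1 * v (circleMap c p.1 p.2) := by
    unfold circleMap
    exact continuous_fst.mul (hv.comp (by fun_prop))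
  rw [h1, ← Complex.integral_comp_polarCoord_symm,
    setIntegral_congr_fun polarCoord.open_target.measurableSet h2,
    setIntegral_indicator (measurableSet_Ioo.prod measurableSet_Ioo)]
  have h3 : polarCoord.target ∩ Set.Ioo (0 : ℝ) R ×ˢ Set.Ioo (-Real.pi) Real.pi =
      Set.Ioo (0 : ℝ) R ×ˢ Set.Ioo (-Real.pi) Real.pi := by
    refine Set.inter_eq_right.2 fun p hp => ?_
    exact ⟨hp.1.1, hp.2⟩
  rw [h3, Measure.volume_eq_prod, setIntegral_prod]
  · rw [← integral_Ioc_eq_integral_Ioo, ← intervalIntegral.integral_of_le hR,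
      ← intervalIntegral.integral_const_mul]
    refine intervalIntegral.integral_congr fun r _ => ?_
    simp only
    rw [← integral_Ioc_eq_integral_Ioo,
      ← intervalIntegral.integral_of_le (by linarith [Real.pi_pos]),
      intervalIntegral.integral_const_mul, Real.circleAverage]
    -- Polar coordinates use angles in `(-π, π)`, circle averages use `(0, 2π)`; periodicity shifts
    -- the window.
    have hp : Function.Periodic (fun θ => v (circleMap c r θ)) (2 * Real.pi) := fun θ => by
      simp only [periodic_circleMap c r θ]
    have := hp.intervalIntegral_add_eq (-Real.pi) 0
    rw [zero_add, show -Real.pi + 2 * Real.pi = Real.pi by ring] at this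
    rw [this, smul_eq_mul]
    have := Real.pi_pos.ne'
    field_simp
  · exact (hcm.continuousOn.integrableOn_compact (isCompact_Icc.prod isCompact_Icc)).mono_set
      (Set.prod_mono Set.Ioo_subset_Icc_self Set.Ioo_subset_Icc_self)

/-! ### Polynomial growth and Cauchy's estimates. -/

/-- An entire function of polynomial growth is a polynomial. -/
theorem exists_polynomial_of_growth {g : ℂ → ℂ} (hg : Differentiable ℂ g) {M : ℝ} {N : ℕ}
    (h : ∀ z, 1 ≤ ‖z‖ → ‖g z‖ ≤ M * ‖z‖ ^ N) : ∃ p : Polynomial ℂ, ∀ z, g z = p.eval z := by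
  have hz : ∀ n, N < n → iteratedDeriv n g 0 = 0 := by
    intro n hn
    have hM : 0 ≤ M := by
      have := h 1 (by simp)
      simp only [norm_one, one_pow, mul_one] at this
      exact (norm_nonneg _).trans this
    -- Cauchy's estimate on `|z| = R`: since `n ≥ N + 1`, the bound `R ^ N / R ^ n` is at most
    -- `R⁻¹`.
    have hb : ∀ R : ℝ, 1 ≤ R → ‖iteratedDeriv n g 0‖ ≤ n.factorial * M * R⁻¹ := by
      intro R hR
      have hR0 : 0 < R := by linarith
      refine (Complex.norm_iteratedDeriv_le_of_forall_mem_sphere_norm_le (C := M * R ^ N) n hR0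
        hg.diffContOnCl fun z hz => ?_).trans ?_
      · have : ‖z‖ = R := by simpa using hz
        simpa [this] using h z (by rw [this]; exact hR)
      · rw [div_le_iff₀ (by positivity)]
        have : R ^ (N + 1) ≤ R ^ n := pow_le_pow_right₀ hR hn
        calc (n.factorial : ℝ) * (M * R ^ N) = n.factorial * M * R⁻¹ * R ^ (N + 1) := by
              field_simp
              ring
          _ ≤ _ := by gcongr
    have ht : Filter.Tendsto (fun R : ℝ => n.factorial * M * R⁻¹) Filter.atTop (nhds 0) := by
      simpa using tendsto_inv_atTop_zero.const_mul ((n.factorial : ℝ) * M)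
    have := ge_of_tendsto ht (Filter.eventually_atTop.2 ⟨1, hb⟩)
    exact norm_le_zero_iff.1 this
  refine ⟨∑ n ∈ Finset.range (N + 1),
    Polynomial.monomial n ((n.factorial : ℂ)⁻¹ * iteratedDeriv n g 0), fun z => ?_⟩
  rw [← Complex.taylorSeries_eq_of_entire' 0 z hg, tsum_eq_sum (s := Finset.range (N + 1)),
    Polynomial.eval_finsetSum]
  · simp [Polynomial.eval_monomial]
  · intro n hn
    rw [hz n (by simpa using hn)]
    simp

/-! ### Finite mass forces polynomial growth. -/

section Growth

variable {g : ℂ → ℂ}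

lemma log_norm_le_log_two_add_norm_sq (w : ℂ) : Real.log ‖w‖ ≤ Real.log (2 + ‖w‖ ^ 2) := by
  rcases eq_or_ne w 0 with rfl | hw
  · simpa using Real.log_nonneg (by norm_num)
  · exact Real.log_le_log (norm_pos_iff.2 hw) (by nlinarith [sq_nonneg (‖w‖ - 1)])

lemma log_two_add_norm_sq_nonneg (w : ℂ) : 0 ≤ Real.log (2 + ‖w‖ ^ 2) :=
  Real.log_nonneg (by nlinarith [sq_nonneg ‖w‖])

/-- By Jensen's formula the average of `log ‖g‖` exceeds `log ‖g c‖` by a nonnegative sum over the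
zeros in the disc. -/
lemma log_norm_le_circleAverage (hg : Differentiable ℂ g) (c : ℂ) {r : ℝ} (hr : 0 < r) :
    Real.log ‖g c‖ ≤ Real.circleAverage (fun z => Real.log (2 + ‖g z‖ ^ 2)) c r := by
  have hu : CircleIntegrable (fun z => Real.log (2 + ‖g z‖ ^ 2)) c r :=
    (continuous_log_two_add_norm_sq hg.continuous).continuousOn.circleIntegrable'
  -- Here `Real.log 0 = 0`, so a zero at the centre needs only a nonnegative average.
  by_cases hc : g c = 0
  · rw [hc, norm_zero, Real.log_zero]
    exact Real.circleAverage_nonneg_of_nonneg fun z _ => log_two_add_norm_sq_nonneg _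
  have ha : AnalyticOnNhd ℂ g (Metric.closedBall c |r|) := fun z _ => hg.analyticAt z
  have hJ := ha.circleAverage_log_norm hr.ne' hc
  have hs : 0 ≤ ∑ᶠ u, MeromorphicOn.divisor g (Metric.closedBall c |r|) u *
      Real.log (r * ‖c - u‖⁻¹) := by
    refine finsum_nonneg fun u => ?_
    by_cases hu : u ∈ Metric.closedBall c |r|
    · refine mul_nonneg (by exact_mod_cast (MeromorphicOn.AnalyticOnNhd.divisor_nonneg ha) u) ?_
      rcases eq_or_ne c u with rfl | hcu
      · simp
      · have hpos : 0 < ‖c - u‖ := norm_pos_iff.2 (sub_ne_zero.2 hcu)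
        apply Real.log_nonneg
        rw [← div_eq_mul_inv, one_le_div hpos, ← dist_eq_norm, dist_comm]
        simpa [abs_of_pos hr] using hu
    · simp [hu]
  have hm : CircleIntegrable (fun z => Real.log ‖g z‖) c r :=
    MeromorphicOn.circleIntegrable_log_norm fun z _ => (hg.analyticAt z).meromorphicAt
  have := Real.circleAverage_mono hm hu fun z _ => log_norm_le_log_two_add_norm_sq (g z)
  linarith

lemma differentiable_comp_exp (hg : Differentiable ℂ g) :
    Differentiable ℂ fun w => g (Complex.exp w) :=
  hg.comp Complex.differentiable_exp

lemma circleMap_zero_exp (s θ : ℝ) :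
    circleMap 0 (Real.exp s) θ = Complex.exp (s + θ * Complex.I) := by
  rw [circleMap_zero, Complex.exp_add, Complex.ofReal_exp]

/-- The factor is `|exp w|²`, the Jacobian of the logarithmic coordinate `w = s + iθ`. -/
lemma logLaplacian_comp_exp (hg : Differentiable ℂ g) (s θ : ℝ) :
    logLaplacian (fun w => g (Complex.exp w)) (s + θ * Complex.I) =
      Real.exp s ^ 2 * logLaplacian g (circleMap 0 (Real.exp s) θ) := by
  have hd : deriv (fun w => g (Complex.exp w)) (s + θ * Complex.I) =
      deriv g (Complex.exp (s + θ * Complex.I)) * Complex.exp (s + θ * Complex.I) :=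
    ((hg _).hasDerivAt.comp _ (Complex.hasDerivAt_exp _)).deriv
  simp only [logLaplacian, hd, circleMap_zero_exp, norm_mul, Complex.norm_exp]
  simp
  ring

/-- In the coordinate `w = log z` circles become vertical segments, and Green's formula gives the
mass between the radii 1 and `exp s`. Writing that radial integral as `∫₀^(exp s) - ∫₀¹` covers
negative `s` as well. -/
lemma verticalFlux_comp_exp_le (hg : Differentiable ℂ g) (hi : Integrable (logLaplacian g))
    (s : ℝ) :
    verticalFlux (fun w => g (Complex.exp w)) s ≤
      verticalFlux (fun w => g (Complex.exp w)) 0 + ∫ z, logLaplacian g z := by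
  have hper : ∀ w, g (Complex.exp (w + 2 * Real.pi * Complex.I)) = g (Complex.exp w) := fun w => by
    rw [Complex.exp_periodic w]
  have hG := verticalFlux_sub_eq_integral_logLaplacian (differentiable_comp_exp hg) hper 0 s
  have cv := continuous_circleAverage (continuous_logLaplacian hg) 0
  have cf : Continuous fun r => r * Real.circleAverage (logLaplacian g) 0 r := continuous_id.mul cv
  have e1 : ∀ t : ℝ, ∫ θ in (0 : ℝ)..(2 * Real.pi),
      logLaplacian (fun w => g (Complex.exp w)) (t + θ * Complex.I) = 2 * Real.pi *
        (((fun r => r * Real.circleAverage (logLaplacian g) 0 r) ∘ Real.exp) t * Real.exp t) := by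
    intro t
    simp only [logLaplacian_comp_exp hg, intervalIntegral.integral_const_mul, Real.circleAverage,
      smul_eq_mul, Function.comp]
    have := Real.pi_pos.ne'
    field_simp
  have e2 : ∫ t in (0 : ℝ)..s, ((fun r => r * Real.circleAverage (logLaplacian g) 0 r) ∘ Real.exp) t
      * Real.exp t =
      ∫ r in (1 : ℝ)..(Real.exp s), r * Real.circleAverage (logLaplacian g) 0 r := by
    rw [intervalIntegral.integral_comp_mul_deriv (fun x _ => Real.hasDerivAt_exp x)
      Real.continuous_exp.continuousOn cf, Real.exp_zero]
  have e3 : 0 ≤ ∫ r in (0 : ℝ)..1, r * Real.circleAverage (logLaplacian g) 0 r :=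
    intervalIntegral.integral_nonneg zero_le_one fun r hr => mul_nonneg hr.1
      (Real.circleAverage_nonneg_of_nonneg fun z _ => logLaplacian_nonneg g z)
  have e4 := intervalIntegral.integral_add_adjacent_intervals
    (cf.intervalIntegrable 0 1 (μ := volume))
    (cf.intervalIntegrable 1 (Real.exp s))
  have e5 := setIntegral_ball_eq_integral_circleAverage (continuous_logLaplacian hg) 0
    (Real.exp_pos s).le
  have e6 : ∫ z in Metric.ball 0 (Real.exp s), logLaplacian g z ≤ ∫ z, logLaplacian g z :=
    setIntegral_le_integral hi (Filter.Eventually.of_forall fun z => logLaplacian_nonneg g z)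
  simp only [e1, intervalIntegral.integral_const_mul, e2] at hG
  nlinarith [Real.pi_pos]

/-- If `Δ log (2 + ‖g‖²)` has finite mass, the circle averages of `log (2 + ‖g‖²)` grow at most
logarithmically. -/
lemma exists_circleAverage_le (hg : Differentiable ℂ g) (hi : Integrable (logLaplacian g)) :
    ∃ K C : ℝ, 0 ≤ C ∧ ∀ ρ r : ℝ, 1 ≤ ρ → 0 ≤ r → r ≤ ρ →
      Real.circleAverage (fun z => Real.log (2 + ‖g z‖ ^ 2)) 0 r ≤ K + C * Real.log ρ := by
  set u : ℂ → ℝ := fun z => Real.log (2 + ‖g z‖ ^ 2) with hu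
  have cu := continuous_circleAverage
    (continuous_log_two_add_norm_sq hg.continuous : Continuous u) 0
  obtain ⟨K₁, hK₁⟩ := (isCompact_Icc (a := (0 : ℝ)) (b := 1)).bddAbove_image cu.continuousOn
  set F := verticalFlux (fun w => g (Complex.exp w)) 0 + ∫ z, logLaplacian g z with hF
  have hp := Real.pi_pos
  -- `K₁` bounds the averages for `r ≤ 1`. Beyond that the flux, at most `F`, is integrated over `0
  -- ≤ s ≤ log r`; the maximum with 0 keeps the bound monotone in `r`.
  refine ⟨K₁, (2 * Real.pi)⁻¹ * max F 0, by positivity, fun ρ r hρ hr hrρ => ?_⟩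
  have hlog : 0 ≤ Real.log ρ := Real.log_nonneg hρ
  have hC : 0 ≤ (2 * Real.pi)⁻¹ * max F 0 := by positivity
  rcases le_or_gt r 1 with h1 | h1
  · have := hK₁ ⟨r, ⟨hr, h1⟩, rfl⟩
    nlinarith [mul_nonneg hC hlog]
  have hr0 : 0 < r := by linarith
  have hlr : 0 ≤ Real.log r := Real.log_nonneg h1.le
  have hA : ∀ s : ℝ, Real.circleAverage u 0 (Real.exp s) = (2 * Real.pi)⁻¹ *
      ∫ θ in (0 : ℝ)..(2 * Real.pi),
        Real.log (2 + ‖(fun w => g (Complex.exp w)) (s + θ * Complex.I)‖ ^ 2) := by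
    intro s
    simp only [Real.circleAverage, smul_eq_mul, hu, circleMap_zero_exp]
  have hd := integral_log_sub_eq_integral_verticalFlux (differentiable_comp_exp hg) 0 (Real.log r)
  have hb : ∫ s in (0 : ℝ)..(Real.log r), verticalFlux (fun w => g (Complex.exp w)) s ≤
      Real.log r * max F 0 := by
    have := intervalIntegral.integral_mono_on hlr
      ((continuous_verticalFlux (differentiable_comp_exp hg)).intervalIntegrable _ _)
      (intervalIntegrable_const (c := max F 0) (μ := volume))
      fun s _ => (verticalFlux_comp_exp_le hg hi s).trans (le_max_left _ _)
    simpa using this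
  have h2 : Real.circleAverage u 0 r - Real.circleAverage u 0 1 ≤
      (2 * Real.pi)⁻¹ * (Real.log r * max F 0) := by
    have e1 := hA (Real.log r)
    have e0 := hA 0
    rw [Real.exp_log hr0] at e1
    rw [Real.exp_zero] at e0
    rw [e1, e0, ← mul_sub, hd]
    gcongr
  have h3 := hK₁ ⟨1, ⟨zero_le_one, le_rfl⟩, rfl⟩
  have h4 : Real.log r ≤ Real.log ρ := Real.log_le_log hr0 hrρ
  have h5 := mul_le_mul_of_nonneg_left h4 hC
  simp only at h3
  nlinarith

/-- An entire function for which `Δ log (2 + ‖g‖²)` has finite mass is a polynomial. -/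
theorem exists_polynomial_of_integrable_logLaplacian (hg : Differentiable ℂ g)
    (hi : Integrable (logLaplacian g)) : ∃ p : Polynomial ℂ, ∀ z, g z = p.eval z := by
  obtain ⟨K, C, hC, hKC⟩ := exists_circleAverage_le hg hi
  set u : ℂ → ℝ := fun z => Real.log (2 + ‖g z‖ ^ 2) with hu
  have hcu : Continuous u := continuous_log_two_add_norm_sq hg.continuous
  have hp := Real.pi_pos
  -- Average Jensen's inequality over the disc of radius `‖c‖` about `c`, which lies in the disc of
  -- radius `2‖c‖` about 0; the factor 4 is the ratio of areas.
  have key : ∀ c : ℂ, 1 ≤ ‖c‖ → Real.log ‖g c‖ ≤ 4 * (K + C * Real.log (2 * ‖c‖)) := by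
    intro c hc
    set R := ‖c‖ with hR
    have hR0 : 0 < R := by linarith
    have i1 : ∀ a b : ℝ,
        IntervalIntegrable (fun r : ℝ => r * Real.circleAverage u c r) volume a b :=
      fun a b => (continuous_id.mul (continuous_circleAverage hcu c)).intervalIntegrable _ _
    have i0 : ∀ a b : ℝ,
        IntervalIntegrable (fun r : ℝ => r * Real.circleAverage u 0 r) volume a b :=
      fun a b => (continuous_id.mul (continuous_circleAverage hcu 0)).intervalIntegrable _ _
    have h1 : R ^ 2 / 2 * Real.log ‖g c‖ ≤ ∫ r in (0 : ℝ)..R, r * Real.circleAverage u c r := by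
      have := intervalIntegral.integral_mono_on hR0.le
        ((by fun_prop : Continuous fun r : ℝ => r * Real.log ‖g c‖).intervalIntegrable _ _)
        (i1 0 R) fun r hr => by
          rcases hr.1.eq_or_lt with h0 | h0
          · simp [← h0]
          · exact mul_le_mul_of_nonneg_left (log_norm_le_circleAverage hg c h0) hr.1
      rw [intervalIntegral.integral_mul_const, integral_id] at this
      simpa using this
    have h2 : ∫ r in (0 : ℝ)..(2 * R), r * Real.circleAverage u 0 r ≤
        (2 * R) ^ 2 / 2 * (K + C * Real.log (2 * R)) := by
      have := intervalIntegral.integral_mono_on (by positivity : 0 ≤ 2 * R) (i0 0 (2 * R))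
        ((by fun_prop : Continuous fun r : ℝ => r * (K + C * Real.log (2 * R))).intervalIntegrable
          _ _) fun r hr => mul_le_mul_of_nonneg_left
            (hKC (2 * R) r (by linarith) hr.1 hr.2) hr.1
      rw [intervalIntegral.integral_mul_const, integral_id] at this
      simpa using this
    have h3 : ∫ z in Metric.ball c R, u z ≤ ∫ z in Metric.ball 0 (2 * R), u z := by
      refine setIntegral_mono_set ?_
        (Filter.Eventually.of_forall fun z => log_two_add_norm_sq_nonneg _)
        (LE.le.eventuallyLE (Metric.ball_subset_ball' ?_))
      · exact (hcu.continuousOn.integrableOn_compact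
          (isCompact_closedBall (0 : ℂ) (2 * R))).mono_set Metric.ball_subset_closedBall
      · rw [dist_zero_right]; linarith
    rw [setIntegral_ball_eq_integral_circleAverage hcu c hR0.le,
      setIntegral_ball_eq_integral_circleAverage hcu 0 (by positivity)] at h3
    have h4 := le_of_mul_le_mul_left h3 (by positivity)
    have h5 : R ^ 2 / 2 * Real.log ‖g c‖ ≤ R ^ 2 / 2 * (4 * (K + C * Real.log (2 * R))) := by
      linarith
    exact le_of_mul_le_mul_left h5 (by positivity)
  refine exists_polynomial_of_growth hg (M := Real.exp (4 * K + 4 * C * Real.log 2))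
    (N := ⌈4 * C⌉₊) fun z hz => ?_
  have hz0 : 0 < ‖z‖ := by linarith
  rcases eq_or_ne (g z) 0 with h0 | h0
  · rw [h0, norm_zero]; positivity
  have hl : 0 ≤ Real.log ‖z‖ := Real.log_nonneg hz
  have hk := key z hz
  rw [Real.log_mul two_ne_zero hz0.ne'] at hk
  have hn : 4 * C * Real.log ‖z‖ ≤ ⌈4 * C⌉₊ * Real.log ‖z‖ :=
    mul_le_mul_of_nonneg_right (Nat.le_ceil _) hl
  calc ‖g z‖ = Real.exp (Real.log ‖g z‖) := (Real.exp_log (norm_pos_iff.2 h0)).symm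
    _ ≤ Real.exp (4 * K + 4 * C * Real.log 2 + ⌈4 * C⌉₊ * Real.log ‖z‖) :=
      Real.exp_le_exp.2 (by linarith)
    _ = _ := by rw [Real.exp_add, Real.exp_nat_mul, Real.exp_log hz0]

end Growth

/-! ### Polynomials have finite mass. -/

lemma pow_le_one_add_pow {t : ℝ} (ht : 0 ≤ t) {i n : ℕ} (hi : i ≤ n) : t ^ i ≤ 1 + t ^ n := by
  rcases le_total t 1 with h | h
  · linarith [pow_le_one₀ ht h (n := i), pow_nonneg ht n]
  · linarith [pow_le_pow_right₀ h hi]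

lemma exists_norm_eval_le (q : Polynomial ℂ) {n : ℕ} (hn : q.natDegree ≤ n) :
    ∃ C : ℝ, 0 ≤ C ∧ ∀ z, ‖q.eval z‖ ≤ C * (1 + ‖z‖ ^ n) := by
  refine ⟨∑ i ∈ Finset.range (n + 1), ‖q.coeff i‖, Finset.sum_nonneg fun _ _ => norm_nonneg _,
    fun z => ?_⟩
  rw [Polynomial.eval_eq_sum_range' (Nat.lt_succ_of_le hn), Finset.sum_mul]
  refine (norm_sum_le _ _).trans (Finset.sum_le_sum fun i hi => ?_)
  rw [norm_mul, norm_pow]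
  exact mul_le_mul_of_nonneg_left
    (pow_le_one_add_pow (norm_nonneg _) (Nat.lt_succ_iff.1 (Finset.mem_range.1 hi)))
    (norm_nonneg _)

/-- `p(z) = zⁿ · p.reverse(1/z)`, and `p.reverse` takes the leading coefficient as its value at 0,
so `‖p(z)‖ ≥ (a/2)‖z‖ⁿ` for large `z`. The two summands of the constant serve small and large `‖z‖`.
-/
lemma exists_norm_pow_natDegree_le {p : Polynomial ℂ} (hp : p ≠ 0) :
    ∃ C : ℝ, 0 ≤ C ∧ ∀ z : ℂ, ‖z‖ ^ p.natDegree ≤ C * (1 + ‖p.eval z‖) := by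
  set a := ‖p.leadingCoeff‖ with ha
  have ha0 : 0 < a := norm_pos_iff.2 (Polynomial.leadingCoeff_ne_zero.2 hp)
  have ht : Filter.Tendsto (fun w => ‖p.reverse.eval w‖) (nhds 0) (nhds a) := by
    have := (p.reverse.continuous.norm.tendsto 0)
    rwa [← Polynomial.coeff_zero_eq_eval_zero, Polynomial.coeff_zero_reverse] at this
  have hev := ht.eventually (lt_mem_nhds (half_lt_self ha0))
  obtain ⟨ε, hε, hεb⟩ := Metric.eventually_nhds_iff.1 hev
  refine ⟨(2 / ε) ^ p.natDegree + 2 / a, by positivity, fun z => ?_⟩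
  rcases le_or_gt ‖z‖ (2 / ε) with h | h
  · have h1 : ‖z‖ ^ p.natDegree ≤ (2 / ε) ^ p.natDegree := by gcongr
    have h2 : 0 ≤ 2 / a := by positivity
    have h3 : 0 ≤ (2 / ε) ^ p.natDegree := by positivity
    nlinarith [norm_nonneg (p.eval z)]
  · have hz : 0 < ‖z‖ := lt_trans (by positivity) h
    have hz' : z ≠ 0 := norm_pos_iff.1 hz
    have h1 : dist z⁻¹ 0 < ε := by
      rw [dist_zero_right, norm_inv, inv_lt_comm₀ hz hε]
      refine lt_trans ?_ h
      rw [inv_eq_one_div]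
      gcongr
      norm_num
    have h2 := hεb h1
    have h3 : p.reverse.eval z⁻¹ * z ^ p.natDegree = p.eval z := by
      let _ : Invertible z := invertibleOfNonzero hz'
      have := Polynomial.eval₂_reverse_mul_pow (RingHom.id ℂ) z p
      rwa [invOf_eq_inv] at this
    have h4 : a / 2 * ‖z‖ ^ p.natDegree ≤ ‖p.eval z‖ := by
      rw [← h3, norm_mul, norm_pow]
      gcongr
    have h5 : ‖z‖ ^ p.natDegree ≤ 2 / a * ‖p.eval z‖ := by
      rw [div_mul_eq_mul_div, le_div_iff₀ ha0]
      linarith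
    have h6 : 0 ≤ (2 / ε) ^ p.natDegree := by positivity
    have h7 : 0 ≤ 2 / a := by positivity
    nlinarith [norm_nonneg (p.eval z)]

lemma exists_norm_eval_le_one_add_norm_eval {p q : Polynomial ℂ} (hp : p ≠ 0)
    (hq : q.natDegree ≤ p.natDegree) :
    ∃ C : ℝ, 0 ≤ C ∧ ∀ z : ℂ, ‖q.eval z‖ ≤ C * (1 + ‖p.eval z‖) := by
  obtain ⟨A, hA, h1⟩ := exists_norm_eval_le q hq
  obtain ⟨B, hB, h2⟩ := exists_norm_pow_natDegree_le hp
  refine ⟨A * (1 + B), by positivity, fun z => (h1 z).trans ?_⟩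
  rw [mul_assoc]
  refine mul_le_mul_of_nonneg_left ?_ hA
  nlinarith [h2 z, norm_nonneg (p.eval z)]

/-- Each of `p'`, `z p'` and `z` has degree at most `deg p`, hence is dominated by `1 + ‖p‖`. This
gives decay `(1 + ‖z‖)⁻⁴`, integrable in real dimension 2. -/
theorem integrable_logLaplacian_polynomial (p : Polynomial ℂ) :
    Integrable (logLaplacian fun z => p.eval z) := by
  have hg : Differentiable ℂ fun z => p.eval z := p.differentiable
  -- Constants are separate: dominating `z` by `1 + ‖p‖` needs positive degree.
  by_cases hd : p.natDegree = 0
  · have : logLaplacian (fun z => p.eval z) = fun _ => 0 := by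
      funext z
      rw [Polynomial.eq_C_of_natDegree_eq_zero hd]
      simp [logLaplacian]
    rw [this]
    exact integrable_zero _ _ _
  have hp : p ≠ 0 := fun h => hd (by simp [h])
  obtain ⟨A, hA, h1⟩ := exists_norm_eval_le_one_add_norm_eval (q := Polynomial.derivative p) hp
    (Polynomial.natDegree_derivative_le p |>.trans (Nat.sub_le _ _))
  obtain ⟨B, hB, h2⟩ := exists_norm_eval_le_one_add_norm_eval
    (q := Polynomial.X * Polynomial.derivative p) hp (by
      refine Polynomial.natDegree_mul_le.trans ?_
      have := Polynomial.natDegree_derivative_le p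
      rw [Polynomial.natDegree_X]
      omega)
  obtain ⟨C, hC, h3⟩ := exists_norm_eval_le_one_add_norm_eval (q := Polynomial.X) hp
    (by rw [Polynomial.natDegree_X]; omega)
  have hint : Integrable fun z : ℂ =>
      (8 * ((A + B) ^ 2 * (1 + C) ^ 2 * 4)) * (1 + ‖z‖) ^ (-(4 : ℝ)) :=
    (integrable_one_add_norm (by rw [Complex.finrank_real_complex]; norm_num)).const_mul _
  refine hint.mono' (continuous_logLaplacian hg).aestronglyMeasurable
    (Filter.Eventually.of_forall fun z => ?_)
  rw [Real.norm_of_nonneg (logLaplacian_nonneg _ _), logLaplacian, Polynomial.deriv]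
  set x := ‖p.eval z‖ with hx
  set d := ‖(Polynomial.derivative p).eval z‖ with hd'
  have hx0 : 0 ≤ x := norm_nonneg _
  have hd0 : 0 ≤ d := norm_nonneg _
  have hz0 : 0 ≤ ‖z‖ := norm_nonneg _
  have b1 : d * (1 + ‖z‖) ≤ (A + B) * (1 + x) := by
    have e1 := h1 z
    have e2 := h2 z
    rw [Polynomial.eval_mul, norm_mul, Polynomial.eval_X] at e2
    nlinarith
  have b2 : 1 + ‖z‖ ≤ (1 + C) * (1 + x) := by
    have := h3 z
    rw [Polynomial.eval_X] at this
    nlinarith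
  have b3 : (1 + x) ^ 2 ≤ 2 * (2 + x ^ 2) := by nlinarith [sq_nonneg (x - 1)]
  have b4 : d ^ 2 * (1 + ‖z‖) ^ 4 ≤ (A + B) ^ 2 * (1 + C) ^ 2 * 4 * (2 + x ^ 2) ^ 2 := by
    calc d ^ 2 * (1 + ‖z‖) ^ 4 = (d * (1 + ‖z‖)) ^ 2 * (1 + ‖z‖) ^ 2 := by ring
      _ ≤ ((A + B) * (1 + x)) ^ 2 * ((1 + C) * (1 + x)) ^ 2 := by gcongr
      _ = (A + B) ^ 2 * (1 + C) ^ 2 * ((1 + x) ^ 2) ^ 2 := by ring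
      _ ≤ (A + B) ^ 2 * (1 + C) ^ 2 * (2 * (2 + x ^ 2)) ^ 2 := by gcongr
      _ = _ := by ring
  rw [Real.rpow_neg (by positivity), show (4 : ℝ) = ((4 : ℕ) : ℝ) by norm_num, Real.rpow_natCast,
    ← div_eq_mul_inv, div_le_div_iff₀ (by positivity) (by positivity)]
  push_cast
  linarith

/-- The metric `(2 + ‖g‖²) |dz|²` of an entire function `g` has finite absolute total curvature
exactly when `g` is a polynomial. -/
theorem hasFiniteTotalCurvature_iff_polynomial {g : ℂ → ℂ} (hg : Differentiable ℂ g) :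
    HasFiniteTotalCurvature (fun z => 2 + ‖g z‖ ^ 2) ↔
      ∃ p : Polynomial ℂ, ∀ z, g z = p.eval z := by
  rw [hasFiniteTotalCurvature_iff_integrable hg]
  refine ⟨exists_polynomial_of_integrable_logLaplacian hg, ?_⟩
  rintro ⟨p, hp⟩
  rw [show g = fun z => p.eval z from funext hp]
  exact integrable_logLaplacian_polynomial p

/-! ### Holomorphic lifts of a graph. -/

lemma fderiv_re_apply {G : ℂ → ℂ} (hG : Differentiable ℂ G) {ψ : ℂ → ℝ}
    (h : ∀ z, ψ z = (G z).re) (z v : ℂ) : fderiv ℝ ψ z v = (deriv G z * v).re := by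
  have h1 : HasFDerivAt G (((ContinuousLinearMap.toSpanSingleton ℂ (deriv G z)) :
      ℂ →L[ℂ] ℂ).restrictScalars ℝ) z := (hG z).hasDerivAt.hasFDerivAt.restrictScalars ℝ
  have h2 := Complex.reCLM.hasFDerivAt.comp z h1
  have e : ψ = Complex.reCLM ∘ G := funext h
  rw [e, h2.fderiv]
  simp [mul_comm]

/-- Cauchy–Riemann: `ψ_x = Re G'` and `ψ_y = Re (iG') = -Im G'`. Hence all lifts share one density.
-/
lemma deriv_eq_two_mul_wirtinger {G : ℂ → ℂ} (hG : Differentiable ℂ G) {ψ : ℂ → ℝ}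
    (h : ∀ z, ψ z = (G z).re) (z : ℂ) : deriv G z = 2 * wirtinger ψ z := by
  rw [wirtinger, fderiv_re_apply hG h, fderiv_re_apply hG h, mul_div_cancel₀ _ two_ne_zero]
  apply Complex.ext <;> simp

lemma wirtinger_re (z : ℂ) : 2 * wirtinger Complex.re z = 1 := by
  rw [← deriv_eq_two_mul_wirtinger (G := fun w => w) differentiable_id (fun _ => rfl)]
  simp

lemma wirtinger_im (z : ℂ) : 2 * wirtinger Complex.im z = -Complex.I := by
  rw [← deriv_eq_two_mul_wirtinger (G := fun w => -Complex.I * w) (by fun_prop) (by simp)]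
  simp

lemma liftDensity_eq {φ : ℂ → ℝ} {F : ℂ → Fin 3 → ℂ} (hF : IsHolomorphicLift F (graph φ)) :
    liftDensity F = fun z => 2 + ‖2 * wirtinger φ z‖ ^ 2 := by
  have hd : ∀ i, Differentiable ℂ fun w => F w i :=
    differentiable_pi.1 hF.isNullImmersion.holomorphic
  funext z
  have h0 := deriv_eq_two_mul_wirtinger (hd 0) (ψ := φ) (fun z => by simp [← hF.re_eq, graph]) z
  have h1 := deriv_eq_two_mul_wirtinger (hd 1) (ψ := Complex.re)
    (fun z => by simp [← hF.re_eq, graph]) z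
  have h2 := deriv_eq_two_mul_wirtinger (hd 2) (ψ := Complex.im)
    (fun z => by simp [← hF.re_eq, graph]) z
  rw [wirtinger_re] at h1
  rw [wirtinger_im] at h2
  rw [liftDensity, Fin.sum_univ_three, h0, h1, h2, norm_one, norm_neg, Complex.norm_I]
  ring

/-- `-iz` has real part `y`, and nullity is `1 + (-i)² = 0`. -/
lemma isHolomorphicLift_graph {φ : ℂ → ℝ} {G : ℂ → ℂ} (hG : Differentiable ℂ G)
    (h : ∀ z, φ z = (G z).re) :
    IsHolomorphicLift (fun z => ![G z, z, -Complex.I * z]) (graph φ) := by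
  have hd : ∀ i, Differentiable ℂ fun z => (![G z, z, -Complex.I * z] : Fin 3 → ℂ) i := by
    intro i
    fin_cases i
    · exact hG
    · exact differentiable_id
    · exact differentiable_id.const_mul (-Complex.I)
  refine ⟨⟨differentiable_pi.2 hd, fun z hz => ?_, fun z => ?_, ?_⟩, fun z i => ?_⟩
  · have := congrFun hz 1
    rw [deriv_pi (fun i => hd i z)] at this
    simp at this
  · simp
  · rintro ⟨c, hc⟩
    have h0 := hc 0
    have h1 := hc 1
    simp only [Matrix.cons_val_one, Matrix.cons_val_zero] at h0 h1
    exact one_ne_zero (h1.trans h0.symm)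
  · fin_cases i <;> simp [graph, h]

/-! ### Polynomials in `x, y` versus polynomials in `z`. -/

/-- Restriction to the real axis of a polynomial in `x, y` and of its `y`-derivative. -/
lemma exists_polynomial_real_axis (P : MvPolynomial (Fin 2) ℝ) :
    ∃ s r : Polynomial ℝ, ∀ x : ℝ, MvPolynomial.eval ![x, 0] P = s.eval x ∧
      HasDerivAt (fun t : ℝ => MvPolynomial.eval ![x, t] P) (r.eval x) 0 := by
  induction P using MvPolynomial.induction_on with
  | C a =>
    refine ⟨Polynomial.C a, 0, fun x => ⟨by simp, ?_⟩⟩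
    simpa using hasDerivAt_const (0 : ℝ) a
  | add p q hp hq =>
    obtain ⟨s₁, r₁, h₁⟩ := hp
    obtain ⟨s₂, r₂, h₂⟩ := hq
    refine ⟨s₁ + s₂, r₁ + r₂, fun x => ⟨by simp [(h₁ x).1, (h₂ x).1], ?_⟩⟩
    simpa using (h₁ x).2.fun_add (h₂ x).2
  | mul_X p i hp =>
    obtain ⟨s, r, h⟩ := hp
    fin_cases i
    · refine ⟨s * Polynomial.X, r * Polynomial.X, fun x => ⟨by simp [(h x).1], ?_⟩⟩
      simpa using (h x).2.mul_const x
    -- The factor `y` vanishes on the axis, so only its own derivative contributes, leaving `s`.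
    · refine ⟨0, s, fun x => ⟨by simp, ?_⟩⟩
      simpa [(h x).1] using (h x).2.fun_mul (hasDerivAt_id (0 : ℝ))

/-- On the real axis `G' = φ_x - iφ_y` is a polynomial in `x`; the identity theorem extends the
equality to the plane. -/
lemma exists_polynomial_deriv_of_re_eq_eval {G : ℂ → ℂ} (hG : Differentiable ℂ G)
    {P : MvPolynomial (Fin 2) ℝ} (h : ∀ z : ℂ, MvPolynomial.eval ![z.re, z.im] P = (G z).re) :
    ∃ p : Polynomial ℂ, ∀ z, deriv G z = p.eval z := by
  obtain ⟨s, r, hsr⟩ := exists_polynomial_real_axis P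
  set p : Polynomial ℂ := s.derivative.map Complex.ofRealHom -
    Polynomial.C Complex.I * r.map Complex.ofRealHom with hp
  have heval : ∀ (q : Polynomial ℝ) (x : ℝ), (q.map Complex.ofRealHom).eval (x : ℂ) = q.eval x :=
    fun q x => Polynomial.eval_map_apply Complex.ofRealHom x
  have hre : ∀ (w e : ℂ) (t : ℝ), HasDerivAt (fun t : ℝ => (G (w + t * e)).re)
      (deriv G (w + t * e) * e).re t := fun w e t =>
    Complex.reCLM.hasFDerivAt.comp_hasDerivAt t (hasDerivAt_comp_line hG w e t)
  have hreal : ∀ x : ℝ, deriv G x = p.eval (x : ℂ) := by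
    intro x
    have h1 : (deriv G x).re = s.derivative.eval x := by
      have a := hre 0 1 x
      have e : (fun t : ℝ => (G (0 + t * 1)).re) = fun t => s.eval t := by
        funext t
        rw [← h, ← (hsr t).1]
        simp
      rw [e] at a
      simpa using a.unique (s.hasDerivAt x)
    have h2 : (deriv G x * Complex.I).re = r.eval x := by
      have a := hre x Complex.I 0
      have e : (fun t : ℝ => (G (x + t * Complex.I)).re) =
          fun t => MvPolynomial.eval ![x, t] P := by
        funext t
        rw [← h]
        simp
      rw [e] at a
      simpa using a.unique (hsr x).2
    rw [hp, Polynomial.eval_sub, Polynomial.eval_mul, Polynomial.eval_C, heval, heval, ← h1, ← h2]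
    apply Complex.ext <;> simp
  refine ⟨p, fun z => ?_⟩
  have a1 : AnalyticOnNhd ℂ (deriv G) Set.univ := fun z _ => (differentiable_deriv hG).analyticAt z
  have a2 : AnalyticOnNhd ℂ (fun z => p.eval z) Set.univ := fun z _ => p.differentiable.analyticAt z
  have ht : Filter.Tendsto (fun x : ℝ => (x : ℂ)) (nhdsWithin 0 {0}ᶜ) (nhdsWithin 0 {0}ᶜ) := by
    refine tendsto_nhdsWithin_of_tendsto_nhds_of_eventually_within _ ?_ ?_
    · exact (Complex.continuous_ofReal.tendsto' 0 0 Complex.ofReal_zero).mono_left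
        nhdsWithin_le_nhds
    · filter_upwards [self_mem_nhdsWithin] with x hx
      simpa using hx
  have hf : ∃ᶠ z in nhdsWithin (0 : ℂ) {0}ᶜ, deriv G z = p.eval z :=
    ht.frequently (Filter.Eventually.of_forall hreal).frequently
  exact congrFun (a1.eq_of_frequently_eq a2 hf) z

lemma exists_derivative_eq (p : Polynomial ℂ) : ∃ q : Polynomial ℂ, q.derivative = p := by
  induction p using Polynomial.induction_on' with
  | add p q hp hq =>
    obtain ⟨a, rfl⟩ := hp
    obtain ⟨b, rfl⟩ := hq
    exact ⟨a + b, by simp⟩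
  | monomial n a =>
    refine ⟨Polynomial.monomial (n + 1) (a / (n + 1)), ?_⟩
    rw [Polynomial.derivative_monomial]
    congr 1
    have : (n : ℂ) + 1 ≠ 0 := Nat.cast_add_one_ne_zero n
    push_cast
    field_simp

lemma exists_mvPolynomial_re_im (q : Polynomial ℂ) : ∃ P Q : MvPolynomial (Fin 2) ℝ, ∀ z : ℂ,
    (q.eval z).re = MvPolynomial.eval ![z.re, z.im] P ∧
      (q.eval z).im = MvPolynomial.eval ![z.re, z.im] Q := by
  induction q using Polynomial.induction_on with
  | C a => exact ⟨MvPolynomial.C a.re, MvPolynomial.C a.im, fun z => by simp⟩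
  | add p q hp hq =>
    obtain ⟨P₁, Q₁, h₁⟩ := hp
    obtain ⟨P₂, Q₂, h₂⟩ := hq
    exact ⟨P₁ + P₂, Q₁ + Q₂, fun z => by simp [(h₁ z).1, (h₁ z).2, (h₂ z).1, (h₂ z).2]⟩
  | monomial n a h =>
    obtain ⟨P, Q, h⟩ := h
    refine ⟨P * MvPolynomial.X 0 - Q * MvPolynomial.X 1,
      P * MvPolynomial.X 1 + Q * MvPolynomial.X 0, fun z => ?_⟩
    rw [pow_succ, ← mul_assoc, Polynomial.eval_mul, Polynomial.eval_X, Complex.mul_re,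
      Complex.mul_im, (h z).1, (h z).2]
    simp

lemma exists_mvPolynomial_of_deriv_eq_eval {G : ℂ → ℂ} (hG : Differentiable ℂ G)
    {p : Polynomial ℂ} (h : ∀ z, deriv G z = p.eval z) :
    ∃ P : MvPolynomial (Fin 2) ℝ, ∀ z : ℂ, (G z).re = MvPolynomial.eval ![z.re, z.im] P := by
  obtain ⟨q, hq⟩ := exists_derivative_eq p
  have hc : ∀ z, G z - q.eval z = G 0 - q.eval 0 := by
    intro z
    refine is_const_of_deriv_eq_zero (f := fun z => G z - q.eval z)
      (hG.sub q.differentiable) (fun w => ?_) z 0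
    rw [deriv_fun_sub (hG w) q.differentiableAt, Polynomial.deriv, hq, h, sub_self]
  obtain ⟨P, _, hP⟩ := exists_mvPolynomial_re_im (q + Polynomial.C (G 0 - q.eval 0))
  refine ⟨P, fun z => ?_⟩
  rw [← (hP z).1, Polynomial.eval_add, Polynomial.eval_C, ← hc z]
  simp

end IsotropicSpace

end

/-! ### Assembly of the main theorem. -/

theorem mainTheorem5 (φ : ℂ → ℝ) (hφ : InnerProductSpace.HarmonicOnNhd φ Set.univ) :
    IsotropicSpace.IsZMCFace (IsotropicSpace.graph φ) ∧
    (IsotropicSpace.IsFiniteTypeZMCFace (IsotropicSpace.graph φ) ↔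
      IsotropicSpace.IsHarmonicPolynomial φ) ∧
    (∀ F : ℂ → Fin 3 → ℂ, IsotropicSpace.IsHolomorphicLift F (IsotropicSpace.graph φ) →
      IsotropicSpace.liftDensity F = fun z => 2 + ‖2 * IsotropicSpace.wirtinger φ z‖ ^ 2) ∧
    (IsotropicSpace.IsFiniteTypeZMCFace (IsotropicSpace.graph φ) ↔
      IsotropicSpace.HasFiniteTotalCurvature
        (fun z => 2 + ‖2 * IsotropicSpace.wirtinger φ z‖ ^ 2)) ∧
    (IsotropicSpace.HasFiniteTotalCurvature
        (fun z => 2 + ‖2 * IsotropicSpace.wirtinger φ z‖ ^ 2) ↔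
      ∃ p : Polynomial ℂ, ∀ z, IsotropicSpace.wirtinger φ z = p.eval z) := by
  obtain ⟨G, hGa, hGre⟩ := hφ.exists_analyticOnNhd_univ_re_eq
  have hG : Differentiable ℂ G := fun z => (hGa z (Set.mem_univ z)).differentiableAt
  have hre : ∀ z, φ z = (G z).re := fun z => (congrFun hGre z).symm
  have hw : ∀ z, 2 * IsotropicSpace.wirtinger φ z = deriv G z := fun z =>
    (IsotropicSpace.deriv_eq_two_mul_wirtinger hG hre z).symm
  have hlift := IsotropicSpace.isHolomorphicLift_graph hG hre
  have hpoly := IsotropicSpace.hasFiniteTotalCurvature_iff_polynomial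
    (IsotropicSpace.differentiable_deriv hG)
  have hmetric : IsotropicSpace.IsFiniteTypeZMCFace (IsotropicSpace.graph φ) ↔
      IsotropicSpace.HasFiniteTotalCurvature
        (fun z => 2 + ‖2 * IsotropicSpace.wirtinger φ z‖ ^ 2) := by
    constructor
    · rintro ⟨F, hF, -, hcurv⟩
      -- The density does not depend on the lift, so whichever lift witnesses finite type gives the
      -- same metric.
      rwa [IsotropicSpace.liftDensity_eq hF] at hcurv
    · intro hcurv
      refine ⟨_, hlift, ?_, ?_⟩ <;> rw [IsotropicSpace.liftDensity_eq hlift]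
      · simp only [hw]
        exact ⟨IsotropicSpace.contDiff_two_add_norm_sq (IsotropicSpace.differentiable_deriv hG),
          fun z => IsotropicSpace.two_add_norm_sq_pos _⟩
      · exact hcurv
  refine ⟨⟨_, hlift⟩, ?_, fun F hF => IsotropicSpace.liftDensity_eq hF, hmetric, ?_⟩
  · rw [hmetric]
    simp only [hw]
    rw [hpoly]
    constructor
    · rintro ⟨p, hp⟩
      obtain ⟨P, hP⟩ := IsotropicSpace.exists_mvPolynomial_of_deriv_eq_eval hG hp
      exact ⟨hφ, P, fun z => (hre z).trans (hP z)⟩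
    · rintro ⟨-, P, hP⟩
      exact IsotropicSpace.exists_polynomial_deriv_of_re_eq_eval hG
        fun z => (hP z).symm.trans (hre z)
  · simp only [hw]
    rw [hpoly]
    constructor
    · rintro ⟨p, hp⟩
      -- The criterion concerns `G' = 2φ_z`, whence the factor `2⁻¹`.
      refine ⟨Polynomial.C 2⁻¹ * p, fun z => ?_⟩
      rw [Polynomial.eval_mul, Polynomial.eval_C, ← hp, ← hw, inv_mul_cancel_left₀ two_ne_zero]
    · rintro ⟨p, hp⟩
      exact ⟨Polynomial.C 2 * p, fun z => by simp [← hw, hp]⟩
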